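/- For a graph $H$, let $\mathscr{C}(H)$ be the set of connected (finite) graphs containing $H$ as a (not necessarily induced) subgraph, and for a set $\mathscr{G}$ of graphs let $R_2(\mathscr{G})$ be the minimum integer $n$ such that every coloring of the edges of the complete graph $K_n$ with at most two colors contains a monochromatic copy of some graph in $\mathscr{G}$. Let $mC_5$ denote the disjoint union of $m$ cycles of length $5$. Then for every integer $m\geq 2$, $$R_2(\mathscr{C}(mC_5)) = 11m-2.$$ That is, every red/blue coloring of the edges of $K_{11m-2}$ contains a monochromatic connected subgraph containing $m$ vertex-disjoint $5$-cycles, while for every $n<11m-2$ some red/blue coloring of the edges of $K_n$ contains no such subgraph. -/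

import Mathlib

/-!
For the lower bound split the vertices into two blocks of order `5m - 1` and a block of fewer than
`m` vertices, and colour edges inside a block red and edges between blocks blue: a red component is
too small for `m C₅`, while each blue `C₅`, not being bipartite, uses a vertex of the small block.

For the upper bound, if both colour graphs are connected it suffices to remove `2m - 1`
monochromatic `5`-cycles greedily, as any ten vertices contain one. Otherwise one colour, say red,
is disconnected and there is a partition `A ∪ Z` with all edges between the parts blue, so that the
blue graph is connected; choose a part `A` with `3m ≤ #A` closed under red adjacency and minimal.
If `#Z < 3m` then `A` is connected in red, and it is enough to find `m` red cycles inside `A` or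
`m` blue cycles anywhere. A blue `C₅` is obtained from a blue `P₄` in `A` and one vertex of `Z`, or
from a blue edge and a further vertex on one side and two vertices on the other. If there are too
few blue edges for this, take a maximum blue matching with `a` edges. The vertices it misses form a
red clique, and each matching edge has an end with at most one blue neighbour among them; the
clique together with these `a` ends contains `m` red cycles and is connected in red.
-/

/-- `copies m H` is `mH`, the disjoint union of `m` copies of the graph `H`. -/
def copies (m : ℕ) {V : Type*} (H : SimpleGraph V) : SimpleGraph (Fin m × V) where
  Adj x y := x.1 = y.1 ∧ H.Adj x.2 y.2
  symm := ⟨fun _ _ h => ⟨h.1.symm, h.2.symm⟩⟩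
  loopless := ⟨fun x h => H.loopless.irrefl x.2 h.2⟩

/-- A family (set) of finite graphs, each graph being given on a vertex set `Fin k`. -/
abbrev GraphFamily : Type := Set (Σ k : ℕ, SimpleGraph (Fin k))

/-- `𝒞(H)`: the set of connected (finite) graphs containing `H` as a (not necessarily induced)
subgraph. -/
def connectedContaining {V : Type*} (H : SimpleGraph V) : GraphFamily :=
  {G | G.2.Connected ∧ H.IsContained G.2}

/-- Every colouring of the edges of the complete graph `K_n` with (at most) two colours contains
a monochromatic copy of some graph of the family `𝒢`: for some colour, the graph formed by the
edges of that colour contains a copy of a member of `𝒢`. -/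
def TwoColorArrows (n : ℕ) (𝒢 : GraphFamily) : Prop :=
  ∀ c : SimpleGraph.TopEdgeLabeling (Fin n) (Fin 2),
    ∃ i : Fin 2, ∃ G ∈ 𝒢, G.2.IsContained (c.labelGraph i)

/-- `R` is the 2-colour Ramsey number `R₂(𝒢)`: the minimum number `n` such that every 2-colouring
of `K_n` contains a monochromatic copy of some graph in `𝒢`. -/
def IsTwoColorRamseyNumber (𝒢 : GraphFamily) (R : ℕ) : Prop :=
  IsLeast {n : ℕ | TwoColorArrows n 𝒢} R

section

open Finset SimpleGraph

local notation "C₅" => cycleGraph 5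
local notation "P₄" => pathGraph 4
local notation "K₂" => (⊤ : SimpleGraph (Fin 2))
local notation "K₁" => (⊥ : SimpleGraph (Fin 1))

section Containment

variable {V W W' : Type*} {G : SimpleGraph V} {H : SimpleGraph W} {K : SimpleGraph W'}

theorem isContained_induce_iff {s : Set V} :
    H ⊑ G.induce s ↔ ∃ f : Copy H G, ∀ w, f w ∈ s := by
  constructor
  · rintro ⟨f⟩
    exact ⟨(Copy.induce G s).comp f, fun w => (f w).2⟩
  · rintro ⟨f, hf⟩
    exact ⟨⟨⟨fun w => ⟨f w, hf w⟩, fun h => f.toHom.map_adj h⟩,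
      fun _ _ h => f.injective (congrArg Subtype.val h)⟩⟩

theorem isContained_induce_mono {s t : Set V} (h : H ⊑ G.induce s) (hst : s ⊆ t) :
    H ⊑ G.induce t :=
  h.trans ⟨(induceHomOfLE G hst).toCopy⟩

theorem isContained_of_isContained_induce {s : Set V} (h : H ⊑ G.induce s) : H ⊑ G :=
  h.trans ⟨Copy.induce G s⟩

theorem exists_card_eq_of_isContained_induce [Fintype W] {S : Finset V}
    (h : H ⊑ G.induce S) :
    ∃ T ⊆ S, #T = Fintype.card W ∧ H ⊑ G.induce T := by
  obtain ⟨f, hf⟩ := isContained_induce_iff.1 h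
  refine ⟨univ.map f.toEmbedding, fun v hv => ?_, card_map _, isContained_induce_iff.2 ⟨f, ?_⟩⟩
  · obtain ⟨w, -, rfl⟩ := mem_map.1 hv
    exact hf w
  · exact fun w => mem_coe.2 (mem_map_of_mem _ (mem_univ w))

theorem sum_isContained_induce_union [DecidableEq V] {S T : Finset V} (hST : Disjoint S T)
    (hH : H ⊑ G.induce S) (hK : K ⊑ G.induce T) : H ⊕g K ⊑ G.induce (S ∪ T : Finset V) := by
  obtain ⟨f, hf⟩ := isContained_induce_iff.1 hH
  obtain ⟨g, hg⟩ := isContained_induce_iff.1 hK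
  refine isContained_induce_iff.2 ⟨⟨⟨Sum.elim f g, ?_⟩, ?_⟩, ?_⟩
  · rintro (a | a) (b | b) hab
    · exact f.toHom.map_adj hab
    · exact absurd hab (not_adj_sum_inl_inr a b)
    · exact absurd hab.symm (not_adj_sum_inl_inr b a)
    · exact g.toHom.map_adj hab
  · exact f.injective.sumElim g.injective fun a b => hST.forall_ne_finset (hf a) (hg b)
  · rintro (a | a)
    exacts [mem_union_left T (hf a), mem_union_right S (hg a)]

theorem sum_isContained_induce_iff [DecidableEq V] [Fintype W] {S : Finset V} :
    H ⊕g K ⊑ G.induce S ↔ ∃ T ⊆ S, #T = Fintype.card W ∧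
      H ⊑ G.induce T ∧ K ⊑ G.induce (S \ T : Finset V) := by
  constructor
  · intro h
    obtain ⟨f, hf⟩ := isContained_induce_iff.1 h
    let T : Finset V := univ.map (Function.Embedding.inl.trans f.toEmbedding)
    have mem_T (w : W) : f (.inl w) ∈ T :=
      mem_map_of_mem (Function.Embedding.inl.trans f.toEmbedding) (mem_univ w)
    have not_mem_T (w : W') : f (.inr w) ∉ T := by
      intro hw
      obtain ⟨w', -, hw'⟩ := mem_map.1 hw
      exact Sum.inl_ne_inr (f.injective hw')
    refine ⟨T, fun v hv => ?_, card_map _, ?_, ?_⟩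
    · obtain ⟨w, -, rfl⟩ := mem_map.1 hv
      exact hf _
    · exact isContained_induce_iff.2 ⟨f.comp Embedding.sumInl.toCopy, mem_T⟩
    · exact isContained_induce_iff.2 ⟨f.comp Embedding.sumInr.toCopy,
        fun w => mem_coe.2 (mem_sdiff.2 ⟨hf _, not_mem_T w⟩)⟩
  · rintro ⟨T, hTS, -, hT, hST⟩
    rw [← union_sdiff_of_subset hTS]
    exact sum_isContained_induce_union disjoint_sdiff hT hST

end Containment

section Copies

variable {V W W' : Type*} {G R B : SimpleGraph V} {H : SimpleGraph W} {K : SimpleGraph W'}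

/-- The disjoint union of `m + k` copies of `H`, split into the first `m` and the last `k`. -/
def copiesAddIso (m k : ℕ) (H : SimpleGraph W) :
    copies (m + k) H ≃g copies m H ⊕g copies k H where
  toEquiv := (finSumFinEquiv.symm.prodCongr (Equiv.refl W)).trans (Equiv.sumProdDistrib _ _ _)
  map_rel_iff' := by
    rintro ⟨i, v⟩ ⟨j, w⟩
    obtain ⟨i, rfl⟩ := finSumFinEquiv.surjective i
    obtain ⟨j, rfl⟩ := finSumFinEquiv.surjective j
    rcases i with i | i <;> rcases j with j | j <;> simp [copies, Fin.ext_iff] <;> lia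

/-- A single copy of `H` is `H` itself. -/
def copiesOneIso (H : SimpleGraph W) : copies 1 H ≃g H where
  toEquiv := Equiv.uniqueProd W (Fin 1)
  map_rel_iff' := by
    rintro ⟨i, v⟩ ⟨j, w⟩
    simp [copies, Subsingleton.elim i j]

theorem copies_zero_isContained : copies 0 H ⊑ G :=
  .of_isEmpty

theorem copies_isContained_copies {k m : ℕ} (hkm : k ≤ m) : copies k H ⊑ copies m H := by
  obtain ⟨l, rfl⟩ := Nat.exists_eq_add_of_le hkm
  exact .trans ⟨Embedding.sumInl.toCopy⟩ ⟨(copiesAddIso k l H).symm.toCopy⟩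

theorem copies_add_isContained_induce_union [DecidableEq V] {m k : ℕ} {S T : Finset V}
    (hST : Disjoint S T) (hS : copies m H ⊑ G.induce S) (hT : copies k H ⊑ G.induce T) :
    copies (m + k) H ⊑ G.induce (S ∪ T : Finset V) :=
  (isContained_congr_left (copiesAddIso m k H)).2 (sum_isContained_induce_union hST hS hT)

theorem copies_succ_isContained_induce_iff [DecidableEq V] [Fintype W] {m : ℕ} {S : Finset V} :
    copies (m + 1) H ⊑ G.induce S ↔ ∃ T ⊆ S, #T = Fintype.card W ∧
      H ⊑ G.induce T ∧ copies m H ⊑ G.induce (S \ T : Finset V) := by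
  rw [add_comm, isContained_congr_left (copiesAddIso 1 m H),
    isContained_congr_left (Iso.sumCongr (copiesOneIso H) (.refl : copies m H ≃g _)),
    sum_isContained_induce_iff]

theorem exists_copies_isContained_and_not_copies_succ_isContained [Nonempty W] [Finite V]
    (H : SimpleGraph W) (G : SimpleGraph V) :
    ∃ a, copies a H ⊑ G ∧ ¬ copies (a + 1) H ⊑ G := by
  cases nonempty_fintype V
  have hbound (a : ℕ) (h : copies a H ⊑ G) : a ≤ Fintype.card V := by
    obtain ⟨f⟩ := h
    simpa using Fintype.card_le_of_injective _
      (f.injective.comp (Prod.mk_left_injective (Classical.arbitrary W)))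
  have hfree : ∃ a, ¬ copies (a + 1) H ⊑ G :=
    ⟨Fintype.card V, fun h => absurd (hbound _ h) (by lia)⟩
  classical
  refine ⟨Nat.find hfree, ?_, Nat.find_spec hfree⟩
  cases ha : Nat.find hfree with
  | zero => exact copies_zero_isContained
  | succ a => exact not_not.1 (Nat.find_min hfree (m := a) (by lia))

theorem copies_isContained_induce_or_copies_isContained_induce [Fintype W] [Fintype W']
    {n : ℕ} {S : Finset V} (hn : ∀ T ⊆ S, n ≤ #T → H ⊑ R.induce T ∨ K ⊑ B.induce T) (a b : ℕ)
    (hS : Fintype.card W * a + Fintype.card W' * b + n ≤ #S) :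
    copies (a + 1) H ⊑ R.induce S ∨ copies (b + 1) K ⊑ B.induce S := by
  classical
  induction hab : a + b generalizing a b S with
  | zero =>
    obtain ⟨rfl, rfl⟩ : a = 0 ∧ b = 0 := by lia
    rw [zero_add, isContained_congr_left (copiesOneIso H),
      isContained_congr_left (copiesOneIso K)]
    exact hn S subset_rfl (by lia)
  | succ k ih =>
    rcases hn S subset_rfl (by lia) with h | h
    all_goals
      obtain ⟨T, hTS, hT, h⟩ := exists_card_eq_of_isContained_induce h
      have hcard := card_sdiff_add_card_eq_card hTS
      have hn' : ∀ T' ⊆ S \ T, n ≤ #T' →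
          H ⊑ R.induce T' ∨ K ⊑ B.induce T' :=
        fun T' hT' => hn T' (hT'.trans sdiff_subset)
    · cases a with
      | zero => exact .inl (copies_succ_isContained_induce_iff.2
          ⟨T, hTS, hT, h, copies_zero_isContained⟩)
      | succ a =>
        refine (ih hn' a b (by lia) (by lia)).imp (fun h' => ?_) (fun h' => ?_)
        · exact copies_succ_isContained_induce_iff.2 ⟨T, hTS, hT, h, h'⟩
        · exact isContained_induce_mono h' (by simp)
    · cases b with
      | zero => exact .inr (copies_succ_isContained_induce_iff.2
          ⟨T, hTS, hT, h, copies_zero_isContained⟩)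
      | succ b =>
        refine (ih hn' a b (by lia) (by lia)).imp (fun h' => ?_) (fun h' => ?_)
        · exact isContained_induce_mono h' (by simp)
        · exact copies_succ_isContained_induce_iff.2 ⟨T, hTS, hT, h, h'⟩

theorem copies_isContained_induce_union [DecidableEq V] [Finite W] {m r : ℕ} {M X : Finset V}
    (hMX : Disjoint M X) (hM : copies m H ⊑ G.induce M) (hX : r * m ≤ #X)
    (hext : ∀ t ⊆ M, ∀ x ⊆ X, H ⊑ G.induce t → #x = r →
      K ⊑ G.induce (t ∪ x : Finset V)) :
    copies m K ⊑ G.induce (M ∪ X : Finset V) := by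
  cases nonempty_fintype W
  induction m generalizing M X with
  | zero => exact copies_zero_isContained
  | succ m ih =>
    obtain ⟨t, htM, -, ht, hM⟩ := copies_succ_isContained_induce_iff.1 hM
    obtain ⟨x, hxX, hx⟩ := exists_subset_card_eq (show r ≤ #X by lia)
    have hcard := card_sdiff_add_card_eq_card hxX
    have hrest : copies m K ⊑ G.induce (M \ t ∪ X \ x : Finset V) :=
      ih (hMX.mono sdiff_subset sdiff_subset) hM (by lia)
        fun t' ht' x' hx' => hext t' (ht'.trans sdiff_subset) x' (hx'.trans sdiff_subset)
    have hone : copies 1 K ⊑ G.induce (t ∪ x : Finset V) :=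
      (isContained_congr_left (copiesOneIso K)).2 (hext t htM x hxX ht hx)
    have hdisj : Disjoint (M \ t ∪ X \ x) (t ∪ x) := by
      simp only [disjoint_union_left, disjoint_union_right]
      exact ⟨⟨sdiff_disjoint, (hMX.mono htM sdiff_subset).symm⟩,
        hMX.mono sdiff_subset hxX, sdiff_disjoint⟩
    rw [← sdiff_union_of_subset htM, ← sdiff_union_of_subset hxX, union_union_union_comm]
    exact copies_add_isContained_induce_union hdisj hrest hone

end Copies

section Components

variable {V W : Type*} {G : SimpleGraph V} {H : SimpleGraph W}

/-- `H` is contained in a single connected component of `G`, that is, in a connected subgraph. -/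
def IsContainedInComponent (H : SimpleGraph W) (G : SimpleGraph V) : Prop :=
  ∃ C : G.ConnectedComponent, H ⊑ C.toSimpleGraph

theorem isContainedInComponent_of_pairwise_reachable [Nonempty W] {s : Set V}
    (hH : H ⊑ G.induce s) (hs : s.Pairwise G.Reachable) : IsContainedInComponent H G := by
  obtain ⟨f, hf⟩ := isContained_induce_iff.1 hH
  let v := f (Classical.arbitrary W)
  refine ⟨G.connectedComponentMk v, isContained_induce_iff.2 ⟨f, fun w => ?_⟩⟩
  refine ConnectedComponent.sound ?_
  obtain hw | hw := eq_or_ne (f w) v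
  · rw [hw]
  · exact hs (hf _) (hf _) hw

theorem pairwise_reachable_of_minimal {k : ℕ} {A : Finset V}
    (hA : ∀ ⦃x⦄, x ∈ A → ∀ ⦃y⦄, G.Adj x y → y ∈ A)
    (hmin : ∀ C ⊂ A, (∀ ⦃x⦄, x ∈ C → ∀ ⦃y⦄, G.Adj x y → y ∈ C) → #C < k)
    (hcard : 2 * k ≤ #A + 1) :
    (A : Set V).Pairwise G.Reachable := by
  classical
  intro x hx y hy _
  by_contra hxy
  have hnear : #{z ∈ A | G.Reachable x z} < k := by
    refine hmin _ (filter_ssubset.2 ⟨y, hy, hxy⟩) fun u hu v huv => ?_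
    rw [mem_filter] at hu ⊢
    exact ⟨hA hu.1 huv, hu.2.trans huv.reachable⟩
  have hfar : #{z ∈ A | ¬ G.Reachable x z} < k := by
    refine hmin _ (filter_ssubset.2 ⟨x, hx, not_not.2 (.refl x)⟩) fun u hu v huv => ?_
    rw [mem_filter] at hu ⊢
    exact ⟨hA hu.1 huv, fun h => hu.2 (h.trans huv.reachable.symm)⟩
  have hadd := card_filter_add_card_filter_not (s := A) (G.Reachable x)
  lia

theorem exists_mem_connectedContaining_isContained_iff [Finite V] :
    (∃ K ∈ connectedContaining H, K.2 ⊑ G) ↔ IsContainedInComponent H G := by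
  constructor
  · rintro ⟨⟨k, K⟩, ⟨hconn, hHK⟩, ⟨f⟩⟩
    have : Nonempty (Fin k) := hconn.nonempty
    obtain ⟨v⟩ := this
    refine ⟨G.connectedComponentMk (f v), hHK.trans ?_⟩
    exact isContained_induce_iff.2
      ⟨f, fun w => ConnectedComponent.sound ((hconn.preconnected w v).map f.toHom)⟩
  · rintro ⟨C, hC⟩
    cases nonempty_fintype C
    let e := C.toSimpleGraph.overFinIso rfl
    refine ⟨⟨_, C.toSimpleGraph.overFin rfl⟩,
      ⟨e.connected_iff.1 C.connected_toSimpleGraph, hC.trans ⟨e.toCopy⟩⟩, ?_⟩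
    exact .trans ⟨e.symm.toCopy⟩ ⟨Copy.induce G C.supp⟩

theorem twoColorArrows_connectedContaining_iff {n : ℕ} :
    TwoColorArrows n (connectedContaining H) ↔
      ∀ G : SimpleGraph (Fin n), IsContainedInComponent H Gᶜ ∨ IsContainedInComponent H G := by
  simp only [TwoColorArrows, exists_mem_connectedContaining_isContained_iff, Fin.exists_fin_two]
  constructor
  · intro h G
    classical
    simpa only [toTopEdgeLabeling_labelGraph, toTopEdgeLabeling_labelGraph_compl] using
      h G.toTopEdgeLabeling
  · intro h c
    have hcompl : (c.labelGraph 1)ᶜ = c.labelGraph 0 := by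
      ext x y
      simp only [compl_adj, TopEdgeLabeling.labelGraph_adj]
      grind
    simpa only [hcompl] using h (c.labelGraph 1)

end Components

section LowerBound

variable {V W : Type*} {G : SimpleGraph V} {H : SimpleGraph W}

theorem eq_of_reachable {α : Type*} {c : V → α} (hc : ∀ x y, G.Adj x y → c x = c y) {x y : V}
    (h : G.Reachable x y) : c x = c y := by
  obtain ⟨w⟩ := h
  induction w with
  | nil => rfl
  | cons hadj _ ih => exact (hc _ _ hadj).trans ih

theorem card_le_of_isContainedInComponent [Fintype V] [Fintype W] {α : Type*} [DecidableEq α]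
    {c : V → α} {s : ℕ} (hc : ∀ x y, G.Adj x y → c x = c y) (hs : ∀ a, #{x | c x = a} ≤ s)
    (h : IsContainedInComponent H G) : Fintype.card W ≤ s := by
  obtain ⟨C, hC⟩ := h
  induction C using ConnectedComponent.ind with | _ v
  obtain ⟨f, hf⟩ := isContained_induce_iff.1 hC
  refine (card_le_card_of_injOn f (fun w _ => ?_) f.injective.injOn).trans (hs (c v))
  exact mem_coe.2 (mem_filter.2 ⟨mem_univ _, eq_of_reachable hc (ConnectedComponent.exact (hf w))⟩)

theorem le_card_of_copies_isContained_of_colorable {k m : ℕ} {S : Finset V}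
    (hH : ¬ H.Colorable k) (hS : (G.induce (S : Set V)ᶜ).Colorable k) (h : copies m H ⊑ G) :
    m ≤ #S := by
  obtain ⟨f⟩ := h
  have hmeet (i : Fin m) : ∃ w, f (i, w) ∈ S := by
    by_contra! hi
    let fi : Copy H G := ⟨⟨fun w => f (i, w), fun h => f.toHom.map_adj ⟨rfl, h⟩⟩,
      fun _ _ h => (Prod.ext_iff.1 (f.injective h)).2⟩
    obtain ⟨g⟩ := (isContained_induce_iff (s := (S : Set V)ᶜ)).2 ⟨fi, hi⟩
    exact hH (hS.of_hom g.toHom)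
  choose w hw using hmeet
  simpa only [card_univ, Fintype.card_fin] using
    card_le_card_of_injOn (s := univ) (fun i => f (i, w i)) (fun i _ => mem_coe.2 (hw i))
      fun i _ j _ h => (Prod.ext_iff.1 (f.injective h)).1

theorem card_filter_val_div_eq_le {n s : ℕ} (hs : 0 < s) (k : ℕ) :
    #{x : Fin n | x.val / s = k} ≤ s := by
  refine (card_le_card_of_injOn (t := Finset.Ico (k * s) (k * s + s)) Fin.val (fun x hx => ?_)
    Fin.val_injective.injOn).trans (by simp)
  have hx : x.val / s = k := by simpa using hx
  have hle := Nat.div_mul_le_self x.val s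
  have hlt := Nat.lt_div_mul_add (a := x.val) hs
  rw [hx] at hle hlt
  exact mem_coe.2 (Finset.mem_Ico.2 ⟨hle, hlt⟩)

theorem card_filter_le_val {n k : ℕ} : #{x : Fin n | k ≤ x.val} ≤ n - k := by
  refine (card_le_card_of_injOn (t := Finset.Ico k n) Fin.val (fun x hx => ?_)
    Fin.val_injective.injOn).trans (by simp)
  exact mem_coe.2 (Finset.mem_Ico.2 ⟨by simpa using hx, x.isLt⟩)

theorem not_twoColorArrows_connectedContaining_copies [Fintype W] (hH : ¬ H.Colorable 2)
    {m n : ℕ} (hn : n + 2 < (2 * Fintype.card W + 1) * m) :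
    ¬ TwoColorArrows n (connectedContaining (copies m H)) := by
  have hcard : 2 < Fintype.card W := by
    by_contra! h
    exact hH (H.colorable_of_fintype.mono h)
  have hm : 0 < m := Nat.pos_of_mul_pos_left (by lia : 0 < (2 * Fintype.card W + 1) * m)
  let s := Fintype.card W * m - 1
  have hs0 : 0 < s := by
    have := Nat.mul_le_mul hcard hm
    lia
  -- `B` is complete multipartite with parts of size at most `s`; the parts after the first two
  -- have fewer than `m` vertices altogether.
  let block (x : Fin n) : ℕ := x.val / s
  let B : SimpleGraph (Fin n) := (⊤ : SimpleGraph ℕ).comap block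
  rw [twoColorArrows_connectedContaining_iff]
  intro h
  rcases h B with hred | hblue
  · have hle := card_le_of_isContainedInComponent (c := block) (s := s)
      (fun x y hxy => by simpa [B, hxy.ne] using hxy) (card_filter_val_div_eq_le hs0) hred
    rw [Fintype.card_prod, Fintype.card_fin] at hle
    lia
  · obtain ⟨C, hC⟩ := hblue
    let late : Finset (Fin n) := {x | 2 * s ≤ x.val}
    have hcol : (B.induce (late : Set (Fin n))ᶜ).Colorable 2 := by
      refine ⟨Coloring.mk (fun x => ⟨block x, ?_⟩) fun hxy hblock => ?_⟩
      · have hx : x.1.val < 2 * s := by simpa [late] using x.2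
        exact (Nat.div_lt_iff_lt_mul hs0).2 hx
      · exact hxy (Fin.val_eq_of_eq hblock)
    have hle := (le_card_of_copies_isContained_of_colorable hH hcol
      (isContained_of_isContained_induce hC)).trans card_filter_le_val
    lia

theorem not_colorable_two_cycleGraph_five : ¬ (C₅).Colorable 2 := by
  intro h
  have hχ := chromaticNumber_cycleGraph_of_odd 5 (by norm_num) (by decide)
  exact absurd (hχ.symm.le.trans h.chromaticNumber_le) (by decide)

end LowerBound

section SmallGraphs

variable {V W : Type*} {G : SimpleGraph V} {H : SimpleGraph W} {s : Set V} {a b c d e : V}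

theorem cycleGraph_five_isContained_induce (hs : ∀ v ∈ [a, b, c, d, e], v ∈ s)
    (hnodup : [a, b, c, d, e].Nodup) (hab : G.Adj a b) (hbc : G.Adj b c) (hcd : G.Adj c d)
    (hde : G.Adj d e) (hea : G.Adj e a) : C₅ ⊑ G.induce s := by
  refine isContained_induce_iff.2 ⟨⟨⟨[a, b, c, d, e].get, ?_⟩, hnodup.injective_get⟩,
    fun i => hs _ ([a, b, c, d, e].get_mem i)⟩
  intro i j hij
  rw [cycleGraph_adj] at hij
  fin_cases i <;> fin_cases j <;> first | exact absurd hij (by decide) | simp_all [adj_comm]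

theorem cycleGraph_five_isContained (hnodup : [a, b, c, d, e].Nodup) (hab : G.Adj a b)
    (hbc : G.Adj b c) (hcd : G.Adj c d) (hde : G.Adj d e) (hea : G.Adj e a) : C₅ ⊑ G :=
  isContained_of_isContained_induce <|
    cycleGraph_five_isContained_induce (s := Set.univ) (by simp) hnodup hab hbc hcd hde hea

theorem pathGraph_four_isContained (hnodup : [a, b, c, d].Nodup) (hab : G.Adj a b)
    (hbc : G.Adj b c) (hcd : G.Adj c d) : P₄ ⊑ G := by
  refine ⟨⟨⟨[a, b, c, d].get, ?_⟩, hnodup.injective_get⟩⟩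
  intro i j hij
  rw [pathGraph_adj] at hij
  fin_cases i <;> fin_cases j <;> first | exact absurd hij (by decide) | simp_all [adj_comm]

theorem exists_path_of_pathGraph_four_isContained_induce (h : P₄ ⊑ G.induce s) :
    ∃ a b c d, (∀ v ∈ [a, b, c, d], v ∈ s) ∧ [a, b, c, d].Nodup ∧
      G.Adj a b ∧ G.Adj b c ∧ G.Adj c d := by
  obtain ⟨f, hf⟩ := isContained_induce_iff.1 h
  refine ⟨f 0, f 1, f 2, f 3, by simp [hf], ?_, ?_, ?_, ?_⟩
  · have hnodup : (List.map f [0, 1, 2, 3]).Nodup := List.Nodup.map f.injective (by decide)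
    exact hnodup
  all_goals exact f.toHom.map_adj (by simp [pathGraph_adj])

theorem top_two_isContained_induce_iff :
    K₂ ⊑ G.induce s ↔ ∃ x ∈ s, ∃ y ∈ s, G.Adj x y := by
  constructor
  · intro h
    obtain ⟨f, hf⟩ := isContained_induce_iff.1 h
    exact ⟨f 0, hf 0, f 1, hf 1, f.toHom.map_adj (by simp)⟩
  · rintro ⟨x, hx, y, hy, hxy⟩
    refine isContained_induce_iff.2 ⟨⟨⟨![x, y], ?_⟩, ?_⟩, ?_⟩
    · intro i j hij
      fin_cases i <;> fin_cases j <;> first | exact absurd rfl hij | exact hxy | exact hxy.symm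
    · intro i j hij
      fin_cases i <;> fin_cases j <;> simp_all [hxy.ne, hxy.ne']
    · intro i
      fin_cases i <;> assumption

theorem isContained_induce_of_isClique [Fintype W] {S : Finset V} (hS : G.IsClique S)
    (hcard : Fintype.card W ≤ #S) : H ⊑ G.induce S := by
  rw [induce_eq_top.2 hS]
  exact isContained_top_iff.2
    (Function.Embedding.nonempty_of_card_le (hcard.trans_eq (Fintype.card_coe S).symm))

theorem not_cliqueFree_three_of_adj (hab : G.Adj a b) (hac : G.Adj a c) (hbc : G.Adj b c) :
    ¬ G.CliqueFree 3 := by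
  classical
  exact fun h => h {a, b, c} (is3Clique_triple_iff.2 ⟨hab, hac, hbc⟩)

theorem not_cliqueFree_succ_of_not_cliqueFreeOn {n : ℕ} (ha : ∀ v ∈ s, G.Adj a v)
    (hs : ¬ G.CliqueFreeOn s n) : ¬ G.CliqueFree (n + 1) := by
  classical
  simp only [CliqueFreeOn, not_forall, not_not] at hs
  obtain ⟨t, hts, ht⟩ := hs
  exact fun h => h _ (ht.insert fun v hv => ha v (hts hv))

theorem cycleGraph_five_isContained_of_pathGraph_four_isContained_induce
    (ha : ∀ v ∈ s, G.Adj a v) (hs : P₄ ⊑ G.induce s) : C₅ ⊑ G := by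
  obtain ⟨w, x, y, z, hmem, hnodup, hwx, hxy, hyz⟩ :=
    exists_path_of_pathGraph_four_isContained_induce hs
  simp only [List.forall_mem_cons] at hmem
  obtain ⟨hw, hx, hy, hz, -⟩ := hmem
  refine cycleGraph_five_isContained (a := a) (List.nodup_cons.2 ⟨fun hmem => ?_, hnodup⟩)
    (ha w hw) hwx hxy hyz (ha z hz).symm
  have has : a ∈ s := by grind
  exact (ha a has).ne rfl

end SmallGraphs

section SmallRamsey

variable {V : Type*} {R B : SimpleGraph V}

theorem adj_or_adj_of_codisjoint (h : Codisjoint R B) {x y : V} (hxy : x ≠ y) :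
    R.Adj x y ∨ B.Adj x y := by
  have hadj : (R ⊔ B).Adj x y := codisjoint_iff.1 h ▸ hxy
  exact hadj

theorem codisjoint_induce (h : Codisjoint R B) (s : Set V) :
    Codisjoint (R.induce s) (B.induce s) := by
  refine codisjoint_iff.2 (top_unique fun x y hxy => ?_)
  exact adj_or_adj_of_codisjoint h (Subtype.coe_injective.ne hxy)

theorem adj_of_pathGraph_four_free (hRB : Codisjoint R B) (hB : ¬ P₄ ⊑ B) {x y z w : V}
    (hxy : B.Adj x y) (hzw : B.Adj z w) (hnodup : [x, y, z, w].Nodup) : R.Adj x z :=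
  (adj_or_adj_of_codisjoint hRB (by grind)).resolve_right fun h =>
    hB (pathGraph_four_isContained (by grind) hxy.symm h hzw)

theorem cycleGraph_five_isContained_or_adj (hRB : Codisjoint R B) (hB : ¬ P₄ ⊑ B)
    {x y z w u : V} (hxy : B.Adj x y) (hzw : B.Adj z w) (hnodup : [x, y, z, w, u].Nodup) :
    C₅ ⊑ R ∨ (B.Adj u x ∧ B.Adj u y) ∨ (B.Adj u z ∧ B.Adj u w) := by
  have hxz := adj_of_pathGraph_four_free hRB hB hxy hzw (by grind)
  have hxw := adj_of_pathGraph_four_free hRB hB hxy hzw.symm (by grind)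
  have hyz := adj_of_pathGraph_four_free hRB hB hxy.symm hzw (by grind)
  have hyw := adj_of_pathGraph_four_free hRB hB hxy.symm hzw.symm (by grind)
  by_cases hu : (B.Adj u x ∧ B.Adj u y) ∨ (B.Adj u z ∧ B.Adj u w)
  · exact .inr hu
  have hu_left : R.Adj u x ∨ R.Adj u y := by
    have := adj_or_adj_of_codisjoint hRB (show u ≠ x by grind)
    have := adj_or_adj_of_codisjoint hRB (show u ≠ y by grind)
    tauto
  have hu_right : R.Adj u z ∨ R.Adj u w := by
    have := adj_or_adj_of_codisjoint hRB (show u ≠ z by grind)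
    have := adj_or_adj_of_codisjoint hRB (show u ≠ w by grind)
    tauto
  left
  rcases hu_left with hux | huy <;> rcases hu_right with huz | huw
  · exact cycleGraph_five_isContained (by grind) hux hxw hyw.symm hyz huz.symm
  · exact cycleGraph_five_isContained (by grind) hux hxz hyz.symm hyw huw.symm
  · exact cycleGraph_five_isContained (by grind) huy hyw hxw.symm hxz huz.symm
  · exact cycleGraph_five_isContained (by grind) huy hyz hxz.symm hxw huw.symm

theorem cycleGraph_five_isContained_or_not_cliqueFree_three [Fintype V] (hRB : Codisjoint R B)
    (hV : 5 ≤ Fintype.card V) (hP : ¬ P₄ ⊑ R) {x y z w : V} (hxy : R.Adj x y) (hzw : R.Adj z w)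
    (hnodup : [x, y, z, w].Nodup) : C₅ ⊑ B ∨ ¬ R.CliqueFree 3 := by
  classical
  obtain ⟨u, -, hu⟩ := exists_mem_notMem_of_card_lt_card (s := {x, y, z, w}) (t := univ)
    (card_le_four.trans_lt (by rw [card_univ]; lia))
  have hu : [x, y, z, w, u].Nodup := by grind
  refine (cycleGraph_five_isContained_or_adj hRB.symm hP hxy hzw hu).imp_right ?_
  rintro (⟨hux, huy⟩ | ⟨huz, huw⟩)
  · exact not_cliqueFree_three_of_adj hux huy hxy
  · exact not_cliqueFree_three_of_adj huz huw hzw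

theorem pathGraph_four_or_cycleGraph_five_or_not_cliqueFree [Fintype V] (hRB : Codisjoint R B)
    (hV : 5 ≤ Fintype.card V) :
    P₄ ⊑ R ∨ C₅ ⊑ B ∨ ¬ R.CliqueFree 3 ∨ ¬ B.CliqueFree 4 := by
  classical
  by_contra h
  simp only [not_or, not_not] at h
  obtain ⟨hP, hC, hR, hB⟩ := h
  have hmeet {x y z w : V} (hxy : R.Adj x y) (hzw : R.Adj z w) : ¬ [x, y, z, w].Nodup :=
    fun hnodup => (cycleGraph_five_isContained_or_not_cliqueFree_three hRB hV hP hxy hzw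
      hnodup).elim hC (fun h => h hR)
  obtain ⟨x, y, hxy⟩ : ∃ x y, R.Adj x y := by
    by_contra! hempty
    obtain ⟨Q, -, hQ⟩ := exists_subset_card_eq (s := (univ : Finset V)) (n := 4)
      (by rw [card_univ]; lia)
    exact hB Q ⟨fun a _ b _ hab => (adj_or_adj_of_codisjoint hRB hab).resolve_left (hempty a b), hQ⟩
  have hblue {a b : V} (ha : a ≠ x ∧ a ≠ y) (hb : b ≠ x ∧ b ≠ y) (hab : a ≠ b) : B.Adj a b :=
    (adj_or_adj_of_codisjoint hRB hab).resolve_left fun h => hmeet hxy h (by grind [hxy.ne])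
  obtain ⟨T, hT, hTcard⟩ := exists_subset_card_eq (s := ({x, y} : Finset V)ᶜ) (n := 3)
    (by rw [card_compl, card_pair hxy.ne]; lia)
  have hTxy : ∀ v ∈ T, v ≠ x ∧ v ≠ y := fun v hv => by simpa using hT hv
  have hTclique : B.IsNClique 3 T :=
    ⟨fun a ha b hb hab => hblue (hTxy a ha) (hTxy b hb) hab, hTcard⟩
  have hred (z : V) (hz : z = x ∨ z = y) : ∃ v ∈ T, R.Adj z v := by
    by_contra! hall
    refine hB _ (hTclique.insert (a := z) fun v hv => ?_)
    exact (adj_or_adj_of_codisjoint hRB (by grind)).resolve_left (hall v hv)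
  obtain ⟨v, hv, hxv⟩ := hred x (.inl rfl)
  obtain ⟨w, hw, hyw⟩ := hred y (.inr rfl)
  obtain rfl | hvw := eq_or_ne v w
  · exact not_cliqueFree_three_of_adj hxy hxv hyw hR
  · exact hmeet hxv hyw (by grind [hxy.ne])

theorem cycleGraph_five_isContained_induce_insert_of_isClique [DecidableEq V] {Q : Finset V}
    (hQ : R.IsClique Q) (hcard : 4 ≤ #Q) {w p q : V} (hw : w ∉ Q) (hp : p ∈ Q) (hq : q ∈ Q)
    (hpq : p ≠ q) (hwp : R.Adj w p) (hwq : R.Adj w q) :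
    C₅ ⊑ R.induce (insert w Q : Finset V) := by
  obtain ⟨r, s, hr, hs, hrs⟩ := (one_lt_card_iff (s := Q \ {p, q})).1
    (by grind [card_sdiff_add_card_eq_card (show {p, q} ⊆ Q by grind), card_pair hpq])
  simp only [mem_sdiff, mem_insert, mem_singleton, not_or] at hr hs
  exact cycleGraph_five_isContained_induce (a := w) (b := p) (c := r) (d := s) (e := q)
    (by grind) (by grind) hwp (hQ hp hr.1 (by grind)) (hQ hr.1 hs.1 hrs) (hQ hs.1 hq (by grind))
    hwq.symm

theorem cycleGraph_five_isContained_of_inter_neighborSet_subsingleton (hRB : Codisjoint R B)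
    {Q : Finset V} (hQ : 4 ≤ #Q) {w w' u : V} (hnodup : [w, w', u].Nodup)
    (hout : ∀ v ∈ [w, w', u], v ∉ Q ∧ (Q ∩ R.neighborSet v : Set V).Subsingleton)
    (hww' : B.Adj w w') : C₅ ⊑ B := by
  classical
  have hle {v : V} (hv : v ∈ [w, w', u]) : #{p ∈ Q | R.Adj v p} ≤ 1 :=
    card_le_one.2 fun p hp q hq => (hout v hv).2 (mem_filter.1 hp) (mem_filter.1 hq)
  have hexists {v : V} (hv : v ∈ [w, w', u]) (z : V) :
      ∃ p ∈ Q, p ≠ z ∧ B.Adj v p ∧ B.Adj u p := by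
    obtain ⟨p, hp, hp'⟩ := exists_mem_notMem_of_card_lt_card (t := Q)
      (s := {z} ∪ ({p ∈ Q | R.Adj v p} ∪ {p ∈ Q | R.Adj u p})) <| by
        have h₁ := card_union_le {z} ({p ∈ Q | R.Adj v p} ∪ {p ∈ Q | R.Adj u p})
        have h₂ := card_union_le {p ∈ Q | R.Adj v p} {p ∈ Q | R.Adj u p}
        have h₃ := hle hv
        have h₄ := hle (v := u) (by simp)
        grind
    simp only [mem_union, mem_singleton, mem_filter, hp, true_and, not_or] at hp'
    have hblue {v : V} (hv : v ∈ [w, w', u]) (h : ¬ R.Adj v p) : B.Adj v p :=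
      (adj_or_adj_of_codisjoint hRB (ne_of_mem_of_not_mem hp (hout v hv).1).symm).resolve_left h
    exact ⟨p, hp, hp'.1, hblue hv hp'.2.1, hblue (by simp) hp'.2.2⟩
  obtain ⟨p, hp, -, hw'p, hup⟩ := hexists (v := w') (by simp) w
  obtain ⟨q, hq, hqp, hwq, huq⟩ := hexists (v := w) (by simp) p
  exact cycleGraph_five_isContained (by grind) hww' hw'p hup.symm huq hwq.symm

theorem monochromatic_cycleGraph_five_of_not_cliqueFree_four [Fintype V] (hRB : Codisjoint R B)
    (hV : 9 ≤ Fintype.card V) (hR : ¬ R.CliqueFree 4) : C₅ ⊑ R ∨ C₅ ⊑ B := by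
  classical
  by_contra h
  obtain ⟨hCR, hCB⟩ := not_or.1 h
  simp only [CliqueFree, not_forall, not_not] at hR
  obtain ⟨Q, hQ⟩ := hR
  have hQc : 5 ≤ #Qᶜ := by
    rw [card_compl, hQ.card_eq]
    lia
  have hout {v : V} (hv : v ∉ Q) : (Q ∩ R.neighborSet v : Set V).Subsingleton := by
    rintro p ⟨hp, hvp⟩ q ⟨hq, hvq⟩
    by_contra hpq
    exact hCR (isContained_of_isContained_induce
      (cycleGraph_five_isContained_induce_insert_of_isClique hQ.1 hQ.2.ge hv hp hq hpq hvp hvq))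
  refine hCR (isContained_of_isContained_induce
    (isContained_induce_of_isClique (S := Qᶜ) (fun w hw w' hw' hne => ?_) (by simpa using hQc)))
  refine (adj_or_adj_of_codisjoint hRB hne).resolve_right fun hww' => hCB ?_
  obtain ⟨u, hu, hu'⟩ := exists_mem_notMem_of_card_lt_card (s := {w, w'}) (t := Qᶜ)
    (card_le_two.trans_lt (by lia))
  simp only [coe_compl, Set.mem_compl_iff, mem_coe] at hw hw'
  rw [mem_compl] at hu
  refine cycleGraph_five_isContained_of_inter_neighborSet_subsingleton hRB hQ.2.ge
    (show [w, w', u].Nodup by grind) (fun v hv => ?_) hww'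
  have hvQ : v ∉ Q := by grind
  exact ⟨hvQ, hout hvQ⟩

theorem monochromatic_cycleGraph_five_of_forall_adj [Fintype V] (hRB : Codisjoint R B)
    (hV : 9 ≤ Fintype.card V) {S : Finset V} (hS : 5 ≤ #S) {v : V} (hv : ∀ x ∈ S, R.Adj v x) :
    C₅ ⊑ R ∨ C₅ ⊑ B := by
  rcases pathGraph_four_or_cycleGraph_five_or_not_cliqueFree (codisjoint_induce hRB S)
    (by simpa using hS) with h | h | h | h
  · exact .inl (cycleGraph_five_isContained_of_pathGraph_four_isContained_induce hv h)
  · exact .inr (isContained_of_isContained_induce h)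
  · exact monochromatic_cycleGraph_five_of_not_cliqueFree_four hRB hV <|
      not_cliqueFree_succ_of_not_cliqueFreeOn hv fun h' => h ((cliqueFree_induce_iff ..).2 h')
  · exact (monochromatic_cycleGraph_five_of_not_cliqueFree_four hRB.symm hV
      fun h' => h (h'.comap ⟨Copy.induce B S⟩)).symm

theorem monochromatic_cycleGraph_five_of_ten_le_card [Fintype V] (hRB : Codisjoint R B)
    (hV : 10 ≤ Fintype.card V) : C₅ ⊑ R ∨ C₅ ⊑ B := by
  classical
  obtain ⟨v⟩ : Nonempty V := Fintype.card_pos_iff.1 (by lia)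
  have hcover : ({v}ᶜ : Finset V) ⊆ R.neighborFinset v ∪ B.neighborFinset v := fun x hx => by
    have hvx : v ≠ x := by
      rintro rfl
      simp at hx
    simpa using adj_or_adj_of_codisjoint hRB hvx
  have hle := (card_le_card hcover).trans (card_union_le _ _)
  rw [card_compl, card_singleton] at hle
  rcases le_or_gt 5 #(R.neighborFinset v) with h | h
  · exact monochromatic_cycleGraph_five_of_forall_adj hRB (by lia) h
      fun x => (R.mem_neighborFinset v x).1
  · exact (monochromatic_cycleGraph_five_of_forall_adj hRB.symm (by lia)
      (S := B.neighborFinset v) (by lia)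
      fun x => (B.mem_neighborFinset v x).1).symm

end SmallRamsey

section Matching

variable {V : Type*} {G R B : SimpleGraph V}

theorem exists_eq_pair_of_top_two_isContained_induce [DecidableEq V] {T : Finset V} (hT : #T = 2)
    (h : K₂ ⊑ G.induce T) : ∃ p q, G.Adj p q ∧ T = {p, q} := by
  obtain ⟨p, hp, q, hq, hpq⟩ := top_two_isContained_induce_iff.1 h
  refine ⟨p, q, hpq, (eq_of_subset_of_card_le ?_ ?_).symm⟩
  · exact insert_subset hp (singleton_subset_iff.2 hq)
  · rw [hT, card_pair hpq.ne]

theorem copies_succ_top_two_isContained_induce_of_adj [DecidableEq V] {a : ℕ} {S : Finset V}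
    {p q : V} (hp : p ∈ S) (hq : q ∈ S) (hpq : G.Adj p q)
    (h : copies a K₂ ⊑ G.induce (S \ {p, q} : Finset V)) : copies (a + 1) K₂ ⊑ G.induce S :=
  copies_succ_isContained_induce_iff.2 ⟨{p, q}, insert_subset hp (singleton_subset_iff.2 hq),
    card_pair hpq.ne, top_two_isContained_induce_iff.2 ⟨p, by simp, q, by simp, hpq⟩, h⟩

theorem eq_of_adj_of_adj_of_not_copies_isContained [DecidableEq V] {a : ℕ} {S U : Finset V}
    {p q : V} (hp : p ∈ S) (hq : q ∈ S) (hpq : G.Adj p q) (hU : U ⊆ S \ {p, q})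
    (h : copies a K₂ ⊑ G.induce ((S \ {p, q}) \ U : Finset V))
    (hmax : ¬ copies (a + 2) K₂ ⊑ G.induce S) {u u' : V} (hu : u ∈ U) (hu' : u' ∈ U)
    (hpu : G.Adj p u) (hqu' : G.Adj q u') : u = u' := by
  by_contra hne
  have huS := mem_sdiff.1 (hU hu)
  have huS' := mem_sdiff.1 (hU hu')
  have := hpq.ne
  refine hmax (copies_succ_top_two_isContained_induce_of_adj hp huS.1 hpu
    (copies_succ_top_two_isContained_induce_of_adj (by grind) (by grind) hqu'
      (isContained_induce_mono h ?_)))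
  rw [coe_subset]
  intro z hz
  grind

theorem exists_isIndepSet_of_maximum_matching [DecidableEq V] {a : ℕ} {S : Finset V}
    (h : copies a K₂ ⊑ G.induce S) (hmax : ¬ copies (a + 1) K₂ ⊑ G.induce S) :
    ∃ U ⊆ S, ∃ Y ⊆ S, Disjoint U Y ∧ #Y = a ∧ #U + 2 * a = #S ∧
      copies a K₂ ⊑ G.induce (S \ U : Finset V) ∧ G.IsIndepSet U ∧
      ∀ y ∈ Y, (U ∩ G.neighborSet y : Set V).Subsingleton := by
  induction a generalizing S with
  | zero =>
    refine ⟨S, subset_rfl, ∅, empty_subset S, disjoint_empty_right S, card_empty, rfl,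
      copies_zero_isContained, fun x hx y hy _ hxy => hmax ?_, by simp⟩
    exact copies_succ_top_two_isContained_induce_of_adj hx hy hxy copies_zero_isContained
  | succ a ih =>
    obtain ⟨T, hTS, hT, hedge, hrest⟩ := copies_succ_isContained_induce_iff.1 h
    rw [Fintype.card_fin] at hT
    obtain ⟨p, q, hpq, rfl⟩ := exists_eq_pair_of_top_two_isContained_induce hT hedge
    have hp : p ∈ S := hTS (by simp)
    have hq : q ∈ S := hTS (by simp)
    obtain ⟨U, hU, Y, hY, hUY, hYcard, hUcard, hmatch, hindep, hone⟩ :=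
      ih hrest fun h' => hmax (copies_succ_top_two_isContained_induce_of_adj hp hq hpq h')
    obtain ⟨y, hy, hyU⟩ :
        ∃ y ∈ ({p, q} : Finset V), (U ∩ G.neighborSet y : Set V).Subsingleton := by
      have heq {u u' : V} (hu : u ∈ U) (hu' : u' ∈ U) := eq_of_adj_of_adj_of_not_copies_isContained
        hp hq hpq hU hmatch hmax hu hu'
      obtain hempty | ⟨u', hu', hqu'⟩ := (U ∩ G.neighborSet q : Set V).eq_empty_or_nonempty
      · exact ⟨q, by simp, by simp [hempty]⟩
      · refine ⟨p, by simp, fun u hu v hv => ?_⟩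
        rw [heq hu.1 hu' hu.2 hqu', heq hv.1 hu' hv.2 hqu']
    have hcard := card_sdiff_add_card_eq_card hTS
    refine ⟨U, hU.trans sdiff_subset, insert y Y, insert_subset (hTS hy) (hY.trans sdiff_subset),
      ?_, ?_, by lia, ?_, hindep, ?_⟩
    · exact disjoint_insert_right.2 ⟨fun h' => (mem_sdiff.1 (hU h')).2 hy, hUY⟩
    · rw [card_insert_of_notMem fun h' => (mem_sdiff.1 (hY h')).2 hy, hYcard]
    · refine copies_succ_top_two_isContained_induce_of_adj (by grind) (by grind) hpq ?_
      rwa [sdiff_right_comm]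
    · exact (forall_mem_insert ..).2 ⟨hyU, hone⟩

theorem copies_bot_isContained_induce {W : Type*} [Fintype W] {m : ℕ} {S : Finset V}
    (h : m * Fintype.card W ≤ #S) : copies m (⊥ : SimpleGraph W) ⊑ G.induce S := by
  obtain ⟨f⟩ : Nonempty (Fin m × W ↪ S) :=
    Function.Embedding.nonempty_of_card_le (by simpa using h)
  exact ⟨⟨⟨f, fun h => h.2.elim⟩, f.injective⟩⟩

theorem exists_adj_adj_of_diff_neighborSet_subsingleton {s U : Finset V} {y : V}
    (hs : 3 ≤ #s) (hsU : s ⊆ U) (hy : (U \ G.neighborSet y : Set V).Subsingleton) :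
    ∃ p ∈ s, ∃ q ∈ s, p ≠ q ∧ G.Adj y p ∧ G.Adj y q := by
  classical
  have hle : #{p ∈ s | ¬ G.Adj y p} ≤ 1 := by
    refine card_le_one.2 fun p hp q hq => ?_
    rw [mem_filter] at hp hq
    exact hy ⟨hsU hp.1, hp.2⟩ ⟨hsU hq.1, hq.2⟩
  have hcard := card_filter_add_card_filter_not (s := s) (G.Adj y)
  obtain ⟨p, q, hp, hq, hpq⟩ := one_lt_card_iff.1 (show 1 < #{p ∈ s | G.Adj y p} by lia)
  rw [mem_filter] at hp hq
  exact ⟨p, hp.1, q, hq.1, hpq, hp.2, hq.2⟩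

theorem copies_cycleGraph_five_isContained_induce_of_isClique [DecidableEq V] {m : ℕ}
    {U Y : Finset V} (hUY : Disjoint U Y) (hU : R.IsClique U)
    (hY : ∀ y ∈ Y, (U \ R.neighborSet y : Set V).Subsingleton) (hYcard : #Y ≤ m)
    (hcard : 5 * m ≤ #U + #Y) : copies m C₅ ⊑ R.induce (U ∪ Y : Finset V) := by
  obtain ⟨k, rfl⟩ := Nat.exists_eq_add_of_le hYcard
  obtain ⟨X, hXU, hX⟩ := exists_subset_card_eq (show 4 * #Y ≤ #U by lia)
  have hrest := card_sdiff_add_card_eq_card hXU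
  have hmixed : copies #Y C₅ ⊑ R.induce (Y ∪ X : Finset V) := by
    refine copies_isContained_induce_union (H := K₁)
      (hUY.mono_left hXU).symm (copies_bot_isContained_induce (by simp)) hX.ge
      fun t htY x hxX ht hx => ?_
    obtain ⟨f, hf⟩ := isContained_induce_iff.1 ht
    obtain ⟨p, hp, q, hq, hpq, hyp, hyq⟩ := exists_adj_adj_of_diff_neighborSet_subsingleton
      (by lia) (hxX.trans hXU) (hY _ (htY (hf 0)))
    have hy : f 0 ∉ x := fun h => disjoint_right.1 hUY (htY (hf 0)) (hXU (hxX h))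
    refine isContained_induce_mono (cycleGraph_five_isContained_induce_insert_of_isClique
      (hU.subset (coe_subset.2 (hxX.trans hXU))) hx.ge hy hp hq hpq hyp hyq) (coe_subset.2 ?_)
    exact insert_subset (mem_union_left _ (hf 0)) subset_union_right
  have hclique : copies k C₅ ⊑ R.induce (U \ X : Finset V) :=
    isContained_induce_of_isClique (hU.subset (coe_subset.2 sdiff_subset))
      (by simp only [Fintype.card_prod, Fintype.card_fin]; lia)
  have hdisj : Disjoint (Y ∪ X) (U \ X) :=
    disjoint_union_left.2 ⟨(hUY.mono_left sdiff_subset).symm, disjoint_sdiff⟩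
  refine isContained_induce_mono (copies_add_isContained_induce_union hdisj hmixed hclique)
    (coe_subset.2 ?_)
  exact union_subset (union_subset subset_union_right (hXU.trans subset_union_left))
    (sdiff_subset.trans subset_union_left)

theorem exists_copies_cycleGraph_five_of_maximum_matching (hRB : Codisjoint R B)
    {m a : ℕ} {S : Finset V} (hm : 1 ≤ m) (ha : a ≤ m) (h : copies a K₂ ⊑ B.induce S)
    (hmax : ¬ copies (a + 1) K₂ ⊑ B.induce S) (hS : 5 * m + a ≤ #S) :
    ∃ T ⊆ S, copies m C₅ ⊑ R.induce T ∧ (T : Set V).Pairwise R.Reachable := by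
  classical
  obtain ⟨U, hU, Y, hY, hUY, hYcard, hUcard, -, hindep, hone⟩ :=
    exists_isIndepSet_of_maximum_matching h hmax
  have hclique : R.IsClique U := fun x hx y hy hxy =>
    (adj_or_adj_of_codisjoint hRB hxy).resolve_right (hindep hx hy hxy)
  have hred {y : V} (hy : y ∈ Y) : (U \ R.neighborSet y : Set V).Subsingleton :=
    (hone y hy).anti fun u hu => ⟨hu.1, (adj_or_adj_of_codisjoint hRB
      (ne_of_mem_of_not_mem hu.1 (disjoint_right.1 hUY hy)).symm).resolve_left hu.2⟩
  refine ⟨U ∪ Y, union_subset hU hY, copies_cycleGraph_five_isContained_induce_of_isClique hUY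
    hclique (fun _ => hred) (by lia) (by lia), ?_⟩
  obtain ⟨u, hu⟩ : U.Nonempty := card_pos.1 (by lia)
  have hUreach {x : V} (hx : x ∈ U) : R.Reachable x u := by
    obtain rfl | hxu := eq_or_ne x u
    exacts [.refl x, (hclique hx hu hxu).reachable]
  have hreach {x : V} (hx : x ∈ U ∪ Y) : R.Reachable x u := by
    rcases mem_union.1 hx with hx | hx
    · exact hUreach hx
    · obtain ⟨p, hp, -, -, -, hxp, -⟩ := exists_adj_adj_of_diff_neighborSet_subsingleton
        (show 3 ≤ #U by lia) subset_rfl (hred hx)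
      exact hxp.reachable.trans (hUreach hp)
  exact fun x hx y hy _ => (hreach hx).trans (hreach hy).symm

theorem cycleGraph_five_or_pathGraph_four_of_disjoint_edges [Fintype V] (hRB : Codisjoint R B)
    (hV : 7 ≤ Fintype.card V) {x y z w : V} (hxy : B.Adj x y) (hzw : B.Adj z w)
    (hnodup : [x, y, z, w].Nodup) : C₅ ⊑ R ∨ P₄ ⊑ B := by
  classical
  by_contra h
  obtain ⟨hC, hP⟩ := not_or.1 h
  have htriangle {u : V} (hu : u ∉ ({x, y, z, w} : Finset V)) :
      (B.Adj u x ∧ B.Adj u y) ∨ (B.Adj u z ∧ B.Adj u w) :=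
    (cycleGraph_five_isContained_or_adj hRB hP hxy hzw (by grind)).resolve_left hC
  have hcard : #(univ : Finset Bool) < #({x, y, z, w}ᶜ : Finset V) := by
    have := card_le_four (a := x) (b := y) (c := z) (d := w)
    rw [card_compl, card_univ, Fintype.card_bool]
    lia
  obtain ⟨u, hu, u', hu', hne, hcolor⟩ := exists_ne_map_eq_of_card_lt_of_maps_to hcard
    (f := fun u => decide (B.Adj u x ∧ B.Adj u y)) (fun _ _ => mem_coe.2 (mem_univ _))
  rw [mem_compl] at hu hu'
  rw [decide_eq_decide] at hcolor
  by_cases hux : B.Adj u x ∧ B.Adj u y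
  · exact hP (pathGraph_four_isContained (by grind) hux.1 hxy (hcolor.1 hux).2.symm)
  · have huz := (htriangle hu).resolve_left hux
    have hu'z := (htriangle hu').resolve_left fun h => hux (hcolor.2 h)
    exact hP (pathGraph_four_isContained (by grind) huz.1 hzw hu'z.2.symm)

theorem cycleGraph_five_or_pathGraph_four_of_seven_le_card [Fintype V] (hRB : Codisjoint R B)
    (hV : 7 ≤ Fintype.card V) : C₅ ⊑ R ∨ P₄ ⊑ B := by
  classical
  obtain ⟨a, ha, hmax⟩ := exists_copies_isContained_and_not_copies_succ_isContained K₂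
    (B.induce (univ : Finset V))
  rcases le_or_gt a 1 with ha1 | ha2
  · obtain ⟨T, -, hT, -⟩ := exists_copies_cycleGraph_five_of_maximum_matching hRB le_rfl ha1 ha hmax
      (by rw [card_univ]; lia)
    rw [isContained_congr_left (copiesOneIso C₅)] at hT
    exact .inl (isContained_of_isContained_induce hT)
  · obtain ⟨T, -, hT, hedge, hrest⟩ := copies_succ_isContained_induce_iff.1
      ((copies_isContained_copies ha2).trans ha)
    obtain ⟨x, y, hxy, rfl⟩ := exists_eq_pair_of_top_two_isContained_induce hT hedge
    rw [isContained_congr_left (copiesOneIso K₂), top_two_isContained_induce_iff] at hrest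
    obtain ⟨z, hz, w, hw, hzw⟩ := hrest
    have := hxy.ne
    have := hzw.ne
    simp only [coe_sdiff, Set.mem_sdiff, mem_coe] at hz hw
    exact cycleGraph_five_or_pathGraph_four_of_disjoint_edges hRB hV hxy hzw (by grind)

end Matching

section CompleteBetween

variable {V : Type*} {G : SimpleGraph V}

theorem pairwise_reachable_of_isCompleteBetween {s t : Set V} (h : G.IsCompleteBetween s t)
    (hs : s.Nonempty) (ht : t.Nonempty) : (s ∪ t).Pairwise G.Reachable := by
  obtain ⟨x, hx⟩ := hs
  obtain ⟨y, hy⟩ := ht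
  have hreach {v : V} (hv : v ∈ s ∪ t) : G.Reachable v x := by
    rcases hv with hv | hv
    · exact (h hv hy).reachable.trans (h hx hy).reachable.symm
    · exact (h hx hv).reachable.symm
  exact fun v hv w hw _ => (hreach hv).trans (hreach hw).symm

theorem cycleGraph_five_isContained_induce_union_of_pathGraph_four {s t : Set V}
    (h : G.IsCompleteBetween s t) (hs : P₄ ⊑ G.induce s) (ht : t.Nonempty) :
    C₅ ⊑ G.induce (s ∪ t) := by
  obtain ⟨a, b, c, d, hmem, hnodup, hab, hbc, hcd⟩ :=
    exists_path_of_pathGraph_four_isContained_induce hs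
  obtain ⟨y, hy⟩ := ht
  have hys : y ∉ s := fun hys => (h hys hy).ne rfl
  exact cycleGraph_five_isContained_induce (a := a) (b := b) (c := c) (d := d) (e := y) (by grind)
    (by grind) hab hbc hcd (h (hmem d (by simp)) hy) (h (hmem a (by simp)) hy).symm

theorem cycleGraph_five_isContained_induce_union_of_top_two_sum {s t : Set V}
    (h : G.IsCompleteBetween s t) (hs : K₂ ⊕g K₁ ⊑ G.induce s) (ht : t.Nontrivial) :
    C₅ ⊑ G.induce (s ∪ t) := by
  obtain ⟨f, hf⟩ := isContained_induce_iff.1 hs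
  obtain ⟨y, hy, z, hz, hyz⟩ := ht
  have hmem (w : Fin 2 ⊕ Fin 1) {v : V} (hv : v ∈ t) : f w ≠ v := (h (hf w) hv).ne
  have hinj {w w' : Fin 2 ⊕ Fin 1} (hw : w ≠ w') : f w ≠ f w' := f.injective.ne hw
  refine cycleGraph_five_isContained_induce (a := f (.inl 0)) (b := f (.inl 1)) (c := y)
    (d := f (.inr 0)) (e := z) (by grind) ?_ (f.toHom.map_adj (by simp)) (h (hf _) hy)
    (h (hf _) hy).symm (h (hf _) hz) (h (hf _) hz).symm
  have := hinj (show Sum.inl 0 ≠ Sum.inl 1 by simp)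
  have := hinj (show Sum.inl 0 ≠ Sum.inr 0 by simp)
  have := hinj (show Sum.inl 1 ≠ Sum.inr 0 by simp)
  grind

variable [DecidableEq V] {m : ℕ} {X Z : Finset V}

theorem copies_cycleGraph_five_isContained_induce_union_of_pathGraph_four
    (h : G.IsCompleteBetween X Z) (hX : copies m P₄ ⊑ G.induce X) (hZ : m ≤ #Z) :
    copies m C₅ ⊑ G.induce (X ∪ Z : Finset V) := by
  refine copies_isContained_induce_union (r := 1) (disjoint_coe.1 h.disjoint) hX (by lia)
    fun t ht x hx hP hcard => ?_
  rw [coe_union]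
  exact cycleGraph_five_isContained_induce_union_of_pathGraph_four
    (fun _ hv _ hw => h (ht hv) (hx hw)) hP (coe_nonempty.2 (card_pos.1 (by lia)))

theorem copies_cycleGraph_five_isContained_induce_union_of_top_two_sum
    (h : G.IsCompleteBetween X Z) (hX : copies m (K₂ ⊕g K₁) ⊑ G.induce X) (hZ : 2 * m ≤ #Z) :
    copies m C₅ ⊑ G.induce (X ∪ Z : Finset V) := by
  refine copies_isContained_induce_union (disjoint_coe.1 h.disjoint) hX hZ
    fun t ht x hx hK hcard => ?_
  rw [coe_union]
  exact cycleGraph_five_isContained_induce_union_of_top_two_sum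
    (fun _ hv _ hw => h (ht hv) (hx hw)) hK (one_lt_card_iff_nontrivial.1 (by lia))

theorem exists_copies_top_two_sum_isContained_induce {a c : ℕ} (h : copies a K₂ ⊑ G.induce X)
    (hX : 3 * a + c ≤ #X) :
    ∃ X' ⊆ X, copies a (K₂ ⊕g K₁) ⊑ G.induce X' ∧ c ≤ #(X \ X') := by
  obtain ⟨M, hMX, hM, hmatch⟩ := exists_card_eq_of_isContained_induce h
  rw [Fintype.card_prod, Fintype.card_fin, Fintype.card_fin] at hM
  have hcard := card_sdiff_add_card_eq_card hMX
  obtain ⟨Y, hY, hYcard⟩ := exists_subset_card_eq (show a ≤ #(X \ M) by lia)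
  have hMY : Disjoint M Y := disjoint_sdiff.mono_right hY
  refine ⟨M ∪ Y, union_subset hMX (hY.trans sdiff_subset), ?_, ?_⟩
  · refine copies_isContained_induce_union (r := 1) hMY hmatch (by lia)
      fun t ht y hy hK hcard => ?_
    exact sum_isContained_induce_union (hMY.mono ht hy) hK
      (bot_isContained_iff_card_le.2 (by simp [hcard]))
  · rw [card_sdiff_of_subset (union_subset hMX (hY.trans sdiff_subset)),
      card_union_of_disjoint hMY]
    lia

theorem copies_cycleGraph_five_isContained_induce_union_of_matchings {a b : ℕ}
    (h : G.IsCompleteBetween X Z) (hX : copies a K₂ ⊑ G.induce X) (hZ : copies b K₂ ⊑ G.induce Z)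
    (hXcard : 3 * a + 2 * b ≤ #X) (hZcard : 3 * b + 2 * a ≤ #Z) :
    copies (a + b) C₅ ⊑ G.induce (X ∪ Z : Finset V) := by
  obtain ⟨X', hX'X, hX', hXrest⟩ := exists_copies_top_two_sum_isContained_induce hX hXcard
  obtain ⟨Z', hZ'Z, hZ', hZrest⟩ := exists_copies_top_two_sum_isContained_induce hZ hZcard
  have hXZ : Disjoint X Z := disjoint_coe.1 h.disjoint
  have hleft := copies_cycleGraph_five_isContained_induce_union_of_top_two_sum
    (Z := Z \ Z') (fun _ hv _ hw => h (hX'X hv) (sdiff_subset hw)) hX' hZrest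
  have hright := copies_cycleGraph_five_isContained_induce_union_of_top_two_sum
    (Z := X \ X') (fun _ hv _ hw => (h (sdiff_subset hw) (hZ'Z hv)).symm) hZ' hXrest
  have hdisj : Disjoint (X' ∪ Z \ Z') (Z' ∪ X \ X') := by
    simp only [disjoint_union_left, disjoint_union_right]
    exact ⟨⟨hXZ.mono hX'X hZ'Z, sdiff_disjoint⟩,
      disjoint_sdiff, hXZ.symm.mono sdiff_subset sdiff_subset⟩
  refine isContained_induce_mono (copies_add_isContained_induce_union hdisj hleft hright)
    (coe_subset.2 ?_)
  exact union_subset (union_subset_union hX'X sdiff_subset)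
    (union_subset (hZ'Z.trans subset_union_right) (sdiff_subset.trans subset_union_left))

end CompleteBetween

section Bipartition

variable {V : Type*} {G R B : SimpleGraph V} {m : ℕ} {A Z : Finset V}

theorem copies_cycleGraph_five_or_copies_cycleGraph_five (hRB : Codisjoint R B) {a b : ℕ}
    (hA : 5 * a + 5 * b + 10 ≤ #A) :
    copies (a + 1) C₅ ⊑ R.induce A ∨ copies (b + 1) C₅ ⊑ B.induce A :=
  copies_isContained_induce_or_copies_isContained_induce (n := 10)
    (fun T _ hT => monochromatic_cycleGraph_five_of_ten_le_card (codisjoint_induce hRB T)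
      (by simpa using hT)) a b (by simpa only [Fintype.card_fin] using hA)

theorem copies_cycleGraph_five_or_copies_pathGraph_four (hRB : Codisjoint R B) {a b : ℕ}
    (hA : 5 * a + 4 * b + 7 ≤ #A) :
    copies (a + 1) C₅ ⊑ R.induce A ∨ copies (b + 1) P₄ ⊑ B.induce A :=
  copies_isContained_induce_or_copies_isContained_induce (n := 7)
    (fun T _ hT => cycleGraph_five_or_pathGraph_four_of_seven_le_card (codisjoint_induce hRB T)
      (by simpa using hT)) a b (by simpa only [Fintype.card_fin] using hA)

variable [DecidableEq V]

theorem copies_cycleGraph_five_or_union_of_le_card (hRB : Codisjoint R B)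
    (h : B.IsCompleteBetween A Z) (hm : 1 ≤ m) (hA : 9 * m ≤ #A + 2) (hZ : m ≤ #Z) :
    copies m C₅ ⊑ R.induce A ∨ copies m C₅ ⊑ B.induce (A ∪ Z : Finset V) := by
  obtain ⟨k, rfl⟩ := Nat.exists_eq_add_of_le' hm
  exact (copies_cycleGraph_five_or_copies_pathGraph_four hRB (by lia)).imp_right
    fun hP => copies_cycleGraph_five_isContained_induce_union_of_pathGraph_four h hP hZ

theorem copies_cycleGraph_five_or_union_of_le_card_add_one (hRB : Codisjoint R B)
    (h : B.IsCompleteBetween A Z) (hm : 2 ≤ m) (hA : 10 * m ≤ #A + 1) (hZ : m ≤ #Z + 1) :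
    copies m C₅ ⊑ R.induce A ∨ copies m C₅ ⊑ B.induce (A ∪ Z : Finset V) := by
  obtain ⟨k, rfl⟩ := Nat.exists_eq_add_of_le' hm
  refine (copies_cycleGraph_five_or_copies_cycleGraph_five hRB (a := k + 1) (b := 0)
    (by lia)).elim .inl fun hC => ?_
  obtain ⟨T, hTA, hT, hC, -⟩ := copies_succ_isContained_induce_iff.1 hC
  rw [Fintype.card_fin] at hT
  have hcard := card_sdiff_add_card_eq_card hTA
  refine (copies_cycleGraph_five_or_copies_pathGraph_four hRB (A := A \ T) (a := k + 1) (b := k)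
    (by lia)).imp (isContained_induce_mono · (coe_subset.2 sdiff_subset)) fun hP => ?_
  have hrest : copies (k + 1) C₅ ⊑ B.induce (A \ T ∪ Z : Finset V) :=
    copies_cycleGraph_five_isContained_induce_union_of_pathGraph_four
      (fun _ hv _ hw => h (sdiff_subset hv) hw) hP (by lia)
  have hTZ : Disjoint T Z := (disjoint_coe.1 h.disjoint).mono_left hTA
  refine copies_succ_isContained_induce_iff.2
    ⟨T, hTA.trans subset_union_left, by rw [hT, Fintype.card_fin], hC, ?_⟩
  rwa [union_sdiff_distrib, sdiff_eq_self_of_disjoint hTZ.symm]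

theorem copies_cycleGraph_five_or_union_of_two_mul_le_card (hRB : Codisjoint R B)
    (h : B.IsCompleteBetween A Z) (hm : 1 ≤ m) (hA : 6 * m ≤ #A + 1) (hZ : 2 * m ≤ #Z) :
    copies m C₅ ⊑ R.induce A ∨ copies m C₅ ⊑ B.induce (A ∪ Z : Finset V) := by
  obtain ⟨a, ha, hmax⟩ := exists_copies_isContained_and_not_copies_succ_isContained K₂ (B.induce A)
  rcases le_or_gt m a with hma | ham
  · exact .inr (copies_cycleGraph_five_isContained_induce_union_of_matchings (b := 0) h
      ((copies_isContained_copies hma).trans ha) copies_zero_isContained (by lia) (by lia))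
  · obtain ⟨T, hTA, hT, -⟩ := exists_copies_cycleGraph_five_of_maximum_matching hRB hm ham.le ha
      hmax (by lia)
    exact .inl (isContained_induce_mono hT (coe_subset.2 hTA))

theorem copies_cycleGraph_five_or_union_of_card_lt (hRB : Codisjoint R B)
    (h : B.IsCompleteBetween A Z) (hm : 2 ≤ m) (hAZ : 11 * m ≤ #A + #Z + 2) (hZ : #Z < 3 * m) :
    copies m C₅ ⊑ R.induce A ∨ copies m C₅ ⊑ B.induce (A ∪ Z : Finset V) := by
  rcases lt_or_ge (#Z + 1) m with hZ₀ | hZ₀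
  · obtain ⟨k, rfl⟩ := Nat.exists_eq_add_of_le' hm
    exact (copies_cycleGraph_five_or_copies_cycleGraph_five hRB (by lia)).imp_right
      (isContained_induce_mono · (coe_subset.2 subset_union_left))
  rcases lt_or_ge #Z m with hZ₁ | hZ₁
  · exact copies_cycleGraph_five_or_union_of_le_card_add_one hRB h hm (by lia) hZ₀
  rcases lt_or_ge #Z (2 * m) with hZ₂ | hZ₂
  · exact copies_cycleGraph_five_or_union_of_le_card hRB h (by lia) (by lia) hZ₁
  · exact copies_cycleGraph_five_or_union_of_two_mul_le_card hRB h (by lia) (by lia) hZ₂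

theorem isContainedInComponent_or_union_of_le_card [NeZero m] (hRB : Codisjoint R B)
    (h : B.IsCompleteBetween A Z) (hA : 3 * m ≤ #A) (hZ : 3 * m ≤ #Z)
    (hAZ : 11 * m ≤ #A + #Z + 2) :
    IsContainedInComponent (copies m C₅) R ∨ copies m C₅ ⊑ B.induce (A ∪ Z : Finset V) := by
  obtain ⟨a, ha, hamax⟩ :=
    exists_copies_isContained_and_not_copies_succ_isContained K₂ (B.induce A)
  obtain ⟨b, hb, hbmax⟩ :=
    exists_copies_isContained_and_not_copies_succ_isContained K₂ (B.induce Z)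
  have hm := NeZero.pos m
  rcases le_or_gt m (a + b) with hab | hab
  · obtain ⟨a', b', ha', hb', rfl⟩ : ∃ a' b', a' ≤ a ∧ b' ≤ b ∧ m = a' + b' :=
      ⟨min a m, m - min a m, by lia⟩
    exact .inr (copies_cycleGraph_five_isContained_induce_union_of_matchings h
      ((copies_isContained_copies ha').trans ha) ((copies_isContained_copies hb').trans hb)
      (by lia) (by lia))
  left
  rcases le_or_gt (5 * m + a) #A with hA' | hA'
  · obtain ⟨T, -, hT, hreach⟩ :=
      exists_copies_cycleGraph_five_of_maximum_matching hRB hm (by lia) ha hamax hA'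
    exact isContainedInComponent_of_pairwise_reachable hT hreach
  · obtain ⟨T, -, hT, hreach⟩ := exists_copies_cycleGraph_five_of_maximum_matching (m := m) hRB hm
      (by lia) hb hbmax (by lia)
    exact isContainedInComponent_of_pairwise_reachable hT hreach

theorem exists_isCompleteBetween_compl [Fintype V] {k : ℕ} (hk : 3 * k ≤ Fintype.card V + 2) :
    ∃ A : Finset V, Gᶜ.IsCompleteBetween A (Aᶜ : Finset V) ∧ k ≤ #A ∧
      (k ≤ #Aᶜ ∨ (A : Set V).Pairwise G.Reachable) := by
  obtain ⟨A, ⟨hA, hkA⟩, hmin⟩ := exists_minimal_of_wellFoundedLT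
    (fun A : Finset V => (∀ ⦃x⦄, x ∈ A → ∀ ⦃y⦄, G.Adj x y → y ∈ A) ∧ k ≤ #A)
    ⟨univ, fun _ _ y _ => mem_univ y, by rw [card_univ]; lia⟩
  refine ⟨A, fun x hx y hy => ?_, hkA, ?_⟩
  · rw [mem_coe, mem_compl] at hy
    exact ⟨ne_of_mem_of_not_mem hx hy, fun hxy => hy (hA hx hxy)⟩
  refine or_iff_not_imp_left.2 fun hAc => pairwise_reachable_of_minimal hA (k := k)
    (fun C hCA hC => ?_) ?_
  · by_contra! hkC
    exact hCA.2 (hmin ⟨hC, hkC⟩ hCA.1)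
  · have hcard := card_add_card_compl A
    lia

end Bipartition

section UpperBound

variable {V : Type*} {R B : SimpleGraph V} {m : ℕ}

theorem monochromatic_component_copies_cycleGraph_five_of_not_preconnected [Fintype V]
    (hRB : Codisjoint R B) (hm : 2 ≤ m) (hV : 11 * m ≤ Fintype.card V + 2) (hR : ¬ R.Preconnected) :
    IsContainedInComponent (copies m C₅) R ∨ IsContainedInComponent (copies m C₅) B := by
  classical
  have : NeZero m := ⟨by lia⟩
  obtain ⟨A, hAc, hA, hlarge⟩ := exists_isCompleteBetween_compl (G := R) (k := 3 * m) (by lia)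
  have hcard := card_add_card_compl A
  have hblue : B.IsCompleteBetween A (Aᶜ : Finset V) :=
    fun _ hx _ hy => disjoint_compl_left.le_of_codisjoint hRB (hAc hx hy)
  have hne : Aᶜ.Nonempty := by
    by_contra! hempty
    obtain rfl := compl_eq_empty_iff A |>.1 hempty
    have hconn := hlarge.resolve_left (by rw [hempty, card_empty]; lia)
    exact hR fun x y => (eq_or_ne x y).elim (· ▸ .refl x) (hconn (by simp) (by simp))
  have hreach : ((A ∪ Aᶜ : Finset V) : Set V).Pairwise B.Reachable := by
    rw [coe_union]
    exact pairwise_reachable_of_isCompleteBetween hblue (coe_nonempty.2 (card_pos.1 (by lia)))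
      (coe_nonempty.2 hne)
  rcases le_or_gt (3 * m) #Aᶜ with hZ | hZ
  · exact (isContainedInComponent_or_union_of_le_card hRB hblue hA hZ (by lia)).imp_right
      (isContainedInComponent_of_pairwise_reachable · hreach)
  · exact (copies_cycleGraph_five_or_union_of_card_lt hRB hblue hm (by lia) hZ).imp
      (isContainedInComponent_of_pairwise_reachable · (hlarge.resolve_left hZ.not_ge))
      (isContainedInComponent_of_pairwise_reachable · hreach)

theorem monochromatic_component_copies_cycleGraph_five [Fintype V] (hRB : Codisjoint R B)
    (hm : 2 ≤ m) (hV : 11 * m ≤ Fintype.card V + 2) :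
    IsContainedInComponent (copies m C₅) R ∨ IsContainedInComponent (copies m C₅) B := by
  by_cases hR : R.Preconnected
  swap
  · exact monochromatic_component_copies_cycleGraph_five_of_not_preconnected hRB hm hV hR
  by_cases hB : B.Preconnected
  swap
  · exact (monochromatic_component_copies_cycleGraph_five_of_not_preconnected hRB.symm
      hm hV hB).symm
  obtain ⟨k, rfl⟩ := Nat.exists_eq_add_of_le' hm
  exact (copies_cycleGraph_five_or_copies_cycleGraph_five hRB (A := univ)
    (by rw [card_univ]; lia)).imp
    (isContainedInComponent_of_pairwise_reachable · fun x _ y _ _ => hR x y)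
    (isContainedInComponent_of_pairwise_reachable · fun x _ y _ _ => hB x y)

theorem twoColorArrows_eleven_mul_sub_two (hm : 2 ≤ m) :
    TwoColorArrows (11 * m - 2) (connectedContaining (copies m C₅)) :=
  twoColorArrows_connectedContaining_iff.2 fun _ =>
    monochromatic_component_copies_cycleGraph_five isCompl_compl.codisjoint.symm hm
      (by rw [Fintype.card_fin]; lia)

end UpperBound

end

theorem mainTheorem5 (m : ℕ) (hm : 2 ≤ m) :
    IsTwoColorRamseyNumber
      (connectedContaining (copies m (SimpleGraph.cycleGraph 5))) (11 * m - 2) := by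
  refine ⟨twoColorArrows_eleven_mul_sub_two hm, fun n hn => ?_⟩
  by_contra! hlt
  exact not_twoColorArrows_connectedContaining_copies not_colorable_two_cycleGraph_five
    (by rw [Fintype.card_fin]; lia) hn
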